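/- Let $R$ be a commutative noetherian local ring, and let $\mathsf{D}^{\mathrm b}_{\mathrm f}(R)$ be the bounded derived category of $R$-complexes with degreewise finitely generated homology. Let $\mathsf{G}$ be the collection of finitely generated Gorenstein projective $R$-modules; here an $R$-module is Gorenstein projective if it is isomorphic to $\operatorname{coker}(P_1\to P_0)$ for some acyclic complex $P$ of projective $R$-modules such that $\operatorname{Hom}_R(P,Q)$ is acyclic for every projective $R$-module $Q$. The $\mathsf{G}$-level of a complex $M$ in $\mathsf{D}^{\mathrm b}_{\mathrm f}(R)$, denoted $\mathsf{G}\text{-}\mathrm{level}\,M$, is $0$ if $M\simeq 0$; it is $1$ if $M$ is nonzero but can be built from modules in $\mathsf{G}$ using shifts, direct summands, and finite direct sums; and for $n\ge 2$ it is $n$ if $n$ is the least integer $i \ge 2$ such that there is an exact triangle $K\to L\oplus M\to N\to \Sigma K$ in $\mathsf{D}^{\mathrm b}_{\mathrm f}(R)$ with $\mathsf{G}\text{-}\mathrm{level}\,K=1$ and $\mathsf{G}\text{-}\mathrm{level}\,N=i-1$ (and $M$ is not of level $0$ or $1$); it is $\infty$ if there is no such $n$. An $R$-complex is perfect if it is isomorphic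 in the derived category to a bounded complex of finitely generated projective $R$-modules. If there exists an integer $\ell$ such that $\mathsf{G}\text{-}\mathrm{level}\,P\le \ell$ holds for every perfect $R$-complex $P$, then $R$ is Gorenstein, that is, $R$ has finite injective dimension as a module over itself. -/

import Mathlib

open CategoryTheory CategoryTheory.Limits CategoryTheory.Pretriangulated

universe w u

noncomputable section

namespace GLevel

section Level

variable {T : Type*} [Category T] [HasZeroObject T] [HasShift T ℤ] [Preadditive T]
  [∀ n : ℤ, (shiftFunctor T n).Additive] [Pretriangulated T] [HasBinaryBiproducts T]

/-- The objects that can be built from objects in `C` using shifts, (direct) summands and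
finite direct sums (the empty one included). -/
inductive BuiltFrom (C : ObjectProperty T) : T → Prop
  | of (X : T) (hX : C X) : BuiltFrom C X
  | zero (X : T) (hX : IsZero X) : BuiltFrom C X
  | shift (X : T) (n : ℤ) (hX : BuiltFrom C X) : BuiltFrom C (X⟦n⟧)
  | sum (X Y : T) (hX : BuiltFrom C X) (hY : BuiltFrom C Y) : BuiltFrom C (X ⊞ Y)
  | summand (X Y : T) (r : Retract X Y) (hY : BuiltFrom C Y) : BuiltFrom C X

/-- `LevelLE C n M` says that the `C`-level of `M` is at most `n`:
* `n = 0`: `M` is a zero object;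
* `n = 1`: `M` can be built from `C` using shifts, summands and finite direct sums;
* `n ≥ 2`: there is an exact triangle `K ⟶ L ⊞ M ⟶ N ⟶ K⟦1⟧` with `K` of level at most `1` and
  `N` of level at most `n - 1`. -/
def LevelLE (C : ObjectProperty T) : ℕ → T → Prop
  | 0, M => IsZero M
  | 1, M => BuiltFrom C M
  | n + 2, M => ∃ (K L N : T) (f : K ⟶ L ⊞ M) (g : L ⊞ M ⟶ N) (h : N ⟶ K⟦(1 : ℤ)⟧),
      Triangle.mk f g h ∈ distTriang T ∧ BuiltFrom C K ∧ LevelLE C (n + 1) N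

/-- The `C`-level of an object `M`: the least `n` with `LevelLE C n M`, and `⊤` if there is no
such `n`. -/
def level (C : ObjectProperty T) (M : T) : ℕ∞ :=
  ⨅ (n : ℕ) (_ : LevelLE C n M), (n : ℕ∞)

end Level

section Ring

variable (R : Type u) [CommRing R]

/-- A complex of projective modules is totally acyclic if it is acyclic and stays so after
applying `Hom_R(-, Q)` for every projective module `Q`. -/
structure IsTotallyAcyclic (P : CochainComplex (ModuleCat.{u} R) ℤ) : Prop where
  projective : ∀ i : ℤ, Module.Projective R (P.X i)
  acyclic : P.Acyclic
  hom_acyclic : ∀ Q : ModuleCat.{u} R, Module.Projective R Q →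
    ∀ (i : ℤ) (f : P.X i ⟶ Q), P.d (i - 1) i ≫ f = 0 →
      ∃ g : P.X (i + 1) ⟶ Q, P.d i (i + 1) ≫ g = f

/-- A module is Gorenstein projective if it is isomorphic to a cokernel in a totally acyclic
complex of projective modules. -/
def IsGorensteinProjective (G : ModuleCat.{u} R) : Prop :=
  ∃ P : CochainComplex (ModuleCat.{u} R) ℤ, IsTotallyAcyclic R P ∧
    Nonempty (G ≅ cokernel (P.d (-1) 0))

variable [HasDerivedCategory.{w} (ModuleCat.{u} R)]

/-- The collection `G` of finitely generated Gorenstein projective modules, viewed in the derived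
category as complexes concentrated in degree `0`. -/
def finGorensteinProjectives : ObjectProperty (DerivedCategory (ModuleCat.{u} R)) :=
  fun X => ∃ G : ModuleCat.{u} R, Module.Finite R G ∧ IsGorensteinProjective R G ∧
    Nonempty (X ≅ (DerivedCategory.singleFunctor (ModuleCat.{u} R) 0).obj G)

/-- The `G`-level of a complex. All objects built from `G` by shifts, finite direct sums, summands
and exact triangles have bounded finitely generated homology (for `R` noetherian), so that the
level may be computed in the full derived category. -/
def gLevel (M : DerivedCategory (ModuleCat.{u} R)) : ℕ∞ :=
  level (finGorensteinProjectives R) M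

/-- A complex is perfect if it is isomorphic in the derived category to a bounded complex of
finitely generated projective modules. -/
def IsPerfect (X : DerivedCategory (ModuleCat.{u} R)) : Prop :=
  ∃ K : CochainComplex (ModuleCat.{u} R) ℤ,
    (∀ i : ℤ, Module.Finite R (K.X i) ∧ Module.Projective R (K.X i)) ∧
    (∃ a b : ℤ, K.IsStrictlyGE a ∧ K.IsStrictlyLE b) ∧
    Nonempty (X ≅ DerivedCategory.Q.obj K)

end Ring

/-- A noetherian local ring is Gorenstein if it has finite injective dimension as a module over
itself. -/
structure IsGorensteinLocalRing (R : Type u) [CommRing R] : Prop where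
  noetherian : IsNoetherianRing R
  isLocal : IsLocalRing R
  finite_injectiveDimension : ∃ n : ℕ, HasInjectiveDimensionLE (ModuleCat.of R R) n

end GLevel

end

noncomputable section

namespace GLevel

/-! ### Ghost maps and the ghost lemma -/

section Ghost

variable {T : Type*} [Category T] [HasShift T ℤ] [Preadditive T]

/-! Ghosts obstruct small level: a composite of `n` ghosts kills every map from an object of level
at most `n` (`LevelLE.comp_eq_zero_of_isGhostComp`). Since R is projective, Ext^{>0}(G, R) = 0 for
every Gorenstein projective G, and cosyzygies of R inherit this. For such an orthogonal N, any class
in Ext^1(C, N) is a ghost (`IsRightOrthogonal.isGhost`), so dimension shifting along an injective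
resolution of R writes a class in Ext^{ℓ+1}(M, R) as a map out of M followed by ℓ ghosts. For M
finitely generated, a truncated resolution A → M is perfect, hence of level at most ℓ, so the class
dies on A. If A reaches far enough to the left, maps from M to R[ℓ+1] are detected on A, so the
class itself is zero. Thus Ext^{ℓ+1}(M, R) = 0 for all finitely generated M, and Baer's criterion
with dimension shifting bounds the injective dimension of R by ℓ. -/

/-- A morphism is `C`-ghost if its composition with every morphism from a shift of an object of `C`
vanishes. -/
def IsGhost (C : ObjectProperty T) {Y Z : T} (φ : Y ⟶ Z) : Prop :=
  ∀ ⦃X : T⦄, C X → ∀ (n : ℤ) (f : X⟦n⟧ ⟶ Y), f ≫ φ = 0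

/-- `IsGhostComp C n f` says that `f` is a composite of `n` morphisms that are `C`-ghost, followed
by an arbitrary morphism. -/
def IsGhostComp (C : ObjectProperty T) : ℕ → ∀ {Y Z : T}, (Y ⟶ Z) → Prop
  | 0, _, _, _ => True
  | n + 1, Y, Z, f => ∃ (W : T) (φ : Y ⟶ W) (ψ : W ⟶ Z),
      IsGhost C φ ∧ IsGhostComp C n ψ ∧ φ ≫ ψ = f

lemma IsGhostComp.of_le {C : ObjectProperty T} {m n : ℕ} (h : m ≤ n) {Y Z : T} {f : Y ⟶ Z}
    (hf : IsGhostComp C n f) : IsGhostComp C m f := by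
  induction m generalizing n Y with
  | zero => trivial
  | succ m ih =>
    obtain _ | n := n
    · lia
    · obtain ⟨W, φ, ψ, hφ, hψ, rfl⟩ := hf
      exact ⟨W, φ, ψ, hφ, ih (by lia) hψ, rfl⟩

/-- The arbitrary last morphism is absorbed, because a ghost precomposed with anything is again a
ghost. -/
lemma IsGhostComp.comp {C : ObjectProperty T} {n : ℕ} {Y Z Z' : T} {f : Y ⟶ Z}
    (hf : IsGhostComp C n f) {g : Z ⟶ Z'} (hg : IsGhost C g) : IsGhostComp C (n + 1) (f ≫ g) := by
  induction n generalizing Y with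
  | zero =>
    refine ⟨Z', f ≫ g, 𝟙 _, fun X hX n h ↦ ?_, trivial, by simp⟩
    rw [← Category.assoc, hg hX]
  | succ n ih =>
    obtain ⟨W, φ, ψ, hφ, hψ, rfl⟩ := hf
    exact ⟨W, φ, ψ ≫ g, hφ, ih hψ, by simp⟩

variable [∀ n : ℤ, (shiftFunctor T n).Additive] [HasBinaryBiproducts T]

lemma BuiltFrom.comp_eq_zero_of_isGhost {C : ObjectProperty T} {X : T} (hX : BuiltFrom C X)
    {Y Z : T} {φ : Y ⟶ Z} (hφ : IsGhost C φ) (n : ℤ) (f : X⟦n⟧ ⟶ Y) : f ≫ φ = 0 := by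
  induction hX generalizing n with
  | of X hX => exact hφ hX n f
  | zero X hX => exact ((shiftFunctor T n).map_isZero hX).eq_of_src _ _
  | shift X m _ ih =>
    rw [← cancel_epi ((shiftFunctorAdd T m n).hom.app X), comp_zero]
    exact (Category.assoc _ _ _).symm.trans (ih (m + n) _)
  | sum X X' _ _ ih ih' =>
    have h : 𝟙 ((X ⊞ X')⟦n⟧) =
        biprod.fst⟦n⟧' ≫ biprod.inl⟦n⟧' + biprod.snd⟦n⟧' ≫ biprod.inr⟦n⟧' := by
      rw [← Functor.map_comp, ← Functor.map_comp, ← Functor.map_add, biprod.total,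
        CategoryTheory.Functor.map_id]
    rw [← Category.id_comp (f ≫ φ), h, Preadditive.add_comp, Category.assoc, Category.assoc,
      ← Category.assoc _ f, ← Category.assoc _ f, ih, ih', comp_zero, comp_zero, add_zero]
  | summand X X' r _ ih =>
    have h := ih n (r.r⟦n⟧' ≫ f)
    rw [Category.assoc] at h
    rw [← Category.id_comp (f ≫ φ), ← CategoryTheory.Functor.map_id, ← r.retract, Functor.map_comp,
      Category.assoc, h, comp_zero]

variable [HasZeroObject T] [Pretriangulated T]

/-- The ghost lemma: a composite of `n` ghosts vanishes on objects of level at most `n`. -/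
lemma LevelLE.comp_eq_zero_of_isGhostComp {C : ObjectProperty T} {n : ℕ} {X : T}
    (hX : LevelLE C n X) {Y Z : T} {φ : Y ⟶ Z} (hφ : IsGhostComp C n φ) (f : X ⟶ Y) :
    f ≫ φ = 0 := by
  induction n using Nat.strong_induction_on generalizing X Y with
  | _ n ih =>
  match n, hX, hφ, ih with
  | 0, hX, _, _ => exact IsZero.eq_of_src hX _ _
  | 1, hX, ⟨W, φ', ψ, hφ', _, h⟩, _ =>
    subst h
    have := BuiltFrom.comp_eq_zero_of_isGhost hX hφ' 0 ((shiftFunctorZero T ℤ).hom.app X ≫ f)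
    rw [Category.assoc, ← comp_zero (f := (shiftFunctorZero T ℤ).hom.app X), cancel_epi] at this
    rw [← Category.assoc, this, zero_comp]
  | n + 2, ⟨K, L, N, i, p, d, hT, hK, hN⟩, ⟨W, φ', ψ, hφ', hψ, h⟩, ih =>
    subst h
    -- The first ghost kills K, so the map factors through N, whose level is one less; the remaining
    -- ghosts kill it there.
    have h0 : i ≫ biprod.snd ≫ f ≫ φ' = 0 := by
      have := BuiltFrom.comp_eq_zero_of_isGhost hK hφ' 0
        ((shiftFunctorZero T ℤ).hom.app K ≫ i ≫ biprod.snd ≫ f)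
      rw [Category.assoc, ← comp_zero (f := (shiftFunctorZero T ℤ).hom.app K), cancel_epi] at this
      simpa using this
    obtain ⟨g, hg⟩ := Triangle.yoneda_exact₂ _ hT _ h0
    change N ⟶ W at g
    change biprod.snd ≫ f ≫ φ' = p ≫ g at hg
    have h1 := ih (n + 1) (by lia) hN hψ g
    have h2 : (biprod.snd : L ⊞ X ⟶ X) ≫ f ≫ φ' ≫ ψ = 0 := by
      rw [← Category.assoc f, ← Category.assoc biprod.snd, hg, Category.assoc, h1, comp_zero]
    rw [← Category.id_comp (f ≫ φ' ≫ ψ), ← (biprod.inr_snd : (biprod.inr : X ⟶ L ⊞ X) ≫ _ = _),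
      Category.assoc, h2, comp_zero]

lemma comp_eq_zero_of_level_le {C : ObjectProperty T} {n : ℕ} {X : T}
    (hX : level C X ≤ n) {Y Z : T} {φ : Y ⟶ Z} (hφ : IsGhostComp C n φ) (f : X ⟶ Y) :
    f ≫ φ = 0 := by
  obtain ⟨m, hm, hmX⟩ : ∃ m ≤ n, LevelLE C m X := by
    by_contra! h
    have : ((n + 1 : ℕ) : ℕ∞) ≤ level C X :=
      le_iInf₂ fun m hm ↦ by
        by_contra! hlt
        exact h m (by have := Nat.cast_lt.mp hlt; lia) hm
    have := Nat.cast_le.mp (this.trans hX)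
    lia
  exact hmX.comp_eq_zero_of_isGhostComp (hφ.of_le hm) f

end Ghost

/-! ### Ext from Gorenstein projective to projective modules -/

section GorensteinProjective

open Abelian

variable {R : Type u} [CommRing R]

/-- The short exact sequence `0 → coker dⁱ⁻¹ → Pⁱ⁺¹ → coker dⁱ → 0` in an acyclic complex. -/
lemma exists_shortExact_cokernel {C : Type*} [Category C] [Abelian C]
    {P : CochainComplex C ℤ} (hP : P.Acyclic) (i : ℤ) :
    ∃ (f : cokernel (P.d (i - 1) i) ⟶ P.X (i + 1))
      (w : f ≫ cokernel.π (P.d i (i + 1)) = 0),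
      cokernel.π (P.d (i - 1) i) ≫ f = P.d i (i + 1) ∧ (ShortComplex.mk f _ w).ShortExact := by
  have h : (ShortComplex.mk (P.d (i - 1) i) (P.d i (i + 1)) (by simp)).Exact :=
    (P.exactAt_iff' (i - 1) i (i + 1) (by simp) (by simp)).1 (hP i)
  let f := cokernel.desc (P.d (i - 1) i) (P.d i (i + 1)) (by simp)
  have hf : cokernel.π (P.d (i - 1) i) ≫ f = P.d i (i + 1) := cokernel.π_desc _ _ _
  have w : f ≫ cokernel.π (P.d i (i + 1)) = 0 := by
    rw [← cancel_epi (cokernel.π (P.d (i - 1) i)), ← Category.assoc, hf, comp_zero,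
      cokernel.condition]
  refine ⟨f, w, hf, ?_⟩
  have : Mono f := h.mono_cokernelDesc
  have hex : (ShortComplex.mk f _ w).Exact := by
    let α : ShortComplex.mk (P.d i (i + 1)) (cokernel.π (P.d i (i + 1))) (by simp) ⟶
        ShortComplex.mk f _ w :=
      { τ₁ := cokernel.π (P.d (i - 1) i)
        τ₂ := 𝟙 _
        τ₃ := 𝟙 _ }
    rw [← ShortComplex.exact_iff_of_epi_of_isIso_of_mono α]
    exact ShortComplex.exact_cokernel _
  exact { exact := hex }

/-- `Ext` into projective modules vanishes on the cokernels of a totally acyclic complex. -/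
lemma IsTotallyAcyclic.ext_cokernel_eq_zero {P : CochainComplex (ModuleCat.{u} R) ℤ}
    (hP : IsTotallyAcyclic R P) (Q : ModuleCat.{u} R) (hQ : Module.Projective R Q) (n : ℕ)
    (i : ℤ) (x : Ext (cokernel (P.d (i - 1) i)) Q (n + 1)) : x = 0 := by
  have hproj (j : ℤ) : Projective (P.X j) :=
    have := hP.projective j
    ModuleCat.projective_of_categoryTheory_projective _
  induction n generalizing i with
  | zero =>
    obtain ⟨j, rfl⟩ : ∃ j, i = j + 1 := ⟨i - 1, by lia⟩
    obtain ⟨f, w, hf, hS⟩ := exists_shortExact_cokernel hP.acyclic j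
    have hj : j + 1 - 1 = j := by lia
    generalize j + 1 - 1 = j' at *
    subst hj
    obtain ⟨y, rfl⟩ := Ext.contravariant_sequence_exact₃ hS Q x
      (Ext.eq_zero_of_projective _) (add_zero 1)
    obtain ⟨y, rfl⟩ := (Ext.mk₀_bijective _ _).2 y
    -- Acyclicity of Hom(P, Q) extends `y` along `f`, so its connecting image vanishes.
    obtain ⟨g, hg⟩ := hP.hom_acyclic Q hQ j' (cokernel.π (P.d (j' - 1) j') ≫ y) (by simp)
    have : y = f ≫ g := by
      rw [← cancel_epi (cokernel.π (P.d (j' - 1) j')), ← Category.assoc, hf, hg]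
    rw [this, ← Ext.mk₀_comp_mk₀]
    exact hS.extClass_comp_assoc _
  | succ n ih =>
    obtain ⟨j, rfl⟩ : ∃ j, i = j + 1 := ⟨i - 1, by lia⟩
    obtain ⟨f, w, hf, hS⟩ := exists_shortExact_cokernel hP.acyclic j
    have hj : j + 1 - 1 = j := by lia
    generalize j + 1 - 1 = j' at *
    subst hj
    obtain ⟨y, rfl⟩ := Ext.contravariant_sequence_exact₃ hS Q x
      (Ext.eq_zero_of_projective _) (add_comm _ _)
    rw [ih _ y, Ext.comp_zero]

lemma IsGorensteinProjective.ext_eq_zero {G : ModuleCat.{u} R} (hG : IsGorensteinProjective R G)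
    (Q : ModuleCat.{u} R) (hQ : Module.Projective R Q) (n : ℕ) (x : Ext G Q (n + 1)) : x = 0 := by
  obtain ⟨P, hP, ⟨e⟩⟩ := hG
  have h := hP.ext_cokernel_eq_zero Q hQ n 0 ((Ext.mk₀ e.inv).comp x (zero_add _))
  have : x = (Ext.mk₀ e.hom).comp ((Ext.mk₀ e.inv).comp x (zero_add _)) (zero_add _) := by
    simp
  rw [this, h, Ext.comp_zero]

end GorensteinProjective

/-! ### Injective dimension tested on finitely generated modules -/

section InjectiveDimension

open Abelian

variable {R : Type u} [CommRing R]

/-- Baer's criterion in terms of `Ext`. -/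
lemma injective_of_ext_finite_eq_zero {N : ModuleCat.{u} R}
    (h : ∀ (M : ModuleCat.{u} R), Module.Finite R M → ∀ x : Ext M N 1, x = 0) : Injective N := by
  rw [← Module.injective_iff_injective_object]
  apply Module.Baer.injective
  intro I g
  let f : ModuleCat.of R I ⟶ ModuleCat.of R R := ModuleCat.ofHom I.subtype
  have : Mono f := (ModuleCat.mono_iff_injective _).2 I.injective_subtype
  have hS : (ShortComplex.mk f _ (cokernel.condition f)).ShortExact :=
    { exact := ShortComplex.exact_cokernel f }
  have hfin : Module.Finite R (cokernel f : ModuleCat.{u} R) :=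
    Module.Finite.of_surjective (cokernel.π f).hom
      ((ModuleCat.epi_iff_surjective _).1 inferInstance)
  obtain ⟨y, hy⟩ := Ext.contravariant_sequence_exact₁ hS N (Ext.mk₀ (ModuleCat.ofHom g))
    (add_zero 1) (h _ hfin _)
  obtain ⟨y, rfl⟩ := (Ext.mk₀_bijective _ _).2 y
  rw [Ext.mk₀_comp_mk₀] at hy
  have hy' := (Ext.mk₀_bijective _ _).1 hy
  refine ⟨y.hom, fun x hx ↦ ?_⟩
  have := congr($(hy').hom ⟨x, hx⟩)
  exact this

lemma hasInjectiveDimensionLE_of_ext_finite_eq_zero {N : ModuleCat.{u} R} (n : ℕ)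
    (h : ∀ (M : ModuleCat.{u} R), Module.Finite R M → ∀ x : Ext M N (n + 1), x = 0) :
    HasInjectiveDimensionLE N n := by
  induction n generalizing N with
  | zero =>
    rw [HasInjectiveDimensionLE, zero_add, ← injective_iff_hasInjectiveDimensionLT_one]
    exact injective_of_ext_finite_eq_zero h
  | succ n ih =>
    obtain ⟨I, hI, f, hf⟩ := EnoughInjectives.presentation N
    have hS : (ShortComplex.mk f _ (cokernel.condition f)).ShortExact :=
      { exact := ShortComplex.exact_cokernel f }
    refine (hS.hasInjectiveDimensionLT_X₃_iff n hI).1 (ih fun M hM x ↦ ?_)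
    obtain ⟨y, rfl⟩ := Ext.covariant_sequence_exact₃ M hS x rfl (h M hM _)
    rw [Ext.eq_zero_of_injective y, Ext.zero_comp]

end InjectiveDimension

/-! ### Brutal truncation -/

section BrutalTruncation

open ComplexShape

variable {C : Type*} [Category C] [Abelian C]

/-- The brutal truncation `A` of a complex `K` in degrees at least `n`, as a subcomplex with
quotient concentrated in degrees less than `n`. -/
lemma exists_brutal_truncation (K : CochainComplex C ℤ) (n : ℤ) :
    ∃ S : ShortComplex (CochainComplex C ℤ), S.ShortExact ∧ S.X₂ = K ∧ S.X₃.IsStrictlyLE (n - 1) ∧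
      S.X₁.IsStrictlyGE n ∧ ∀ i, n ≤ i → Nonempty (S.X₁.X i ≅ S.X₂.X i) := by
  let e := embeddingUpIntLE (n - 1)
  let B : CochainComplex C ℤ := (K.restriction e).extend e
  let g : K ⟶ B :=
    e.liftExtend (𝟙 _) fun j hj ↦ (hj.false_of_isTruncLE).elim
  have hlt (i : ℤ) (hi : i < n) : IsIso (g.f i) := by
    have h : e.f (n - 1 - i).toNat = i := by
      simp only [e, embeddingUpIntLE_f]
      lia
    refine (e.isIso_liftExtend_f_iff _ _ h).2 ?_
    rw [HomologicalComplex.id_f]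
    infer_instance
  have hB : B.IsStrictlyLE (n - 1) :=
    inferInstanceAs (HomologicalComplex.IsStrictlySupported ((K.restriction e).extend e) e)
  have hge (i : ℤ) (hi : n ≤ i) : g.f i = 0 :=
    (CochainComplex.isZero_of_isStrictlyLE _ (n - 1) i).eq_of_tgt _ _
  have hepi : Epi g := by
    have (i : ℤ) : Epi (g.f i) := by
      by_cases hi : i < n
      · have := hlt i hi
        infer_instance
      · exact (CochainComplex.isZero_of_isStrictlyLE _ (n - 1) i).epi _
    exact HomologicalComplex.epi_of_epi_f g this
  have hS : (ShortComplex.mk _ g (kernel.condition g)).ShortExact :=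
    { exact := ShortComplex.exact_kernel g }
  have hSi (i : ℤ) := hS.map_of_exact (HomologicalComplex.eval C (up ℤ) i)
  refine ⟨_, hS, rfl, hB, ?_, fun i hi ↦ ?_⟩
  · rw [CochainComplex.isStrictlyGE_iff]
    intro i hi
    have := hlt i hi
    have hm : Mono ((kernel.ι g).f i) := (hSi i).mono_f
    have h0 : (kernel.ι g).f i ≫ g.f i = 0 := ((ShortComplex.mk _ g (kernel.condition g)).map
      (HomologicalComplex.eval C (up ℤ) i)).zero
    rw [← zero_comp (f := g.f i), cancel_mono] at h0
    exact IsZero.of_mono_eq_zero _ h0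
  · have hm : Mono ((kernel.ι g).f i) := (hSi i).mono_f
    have he : Epi ((kernel.ι g).f i) := (hSi i).exact.epi_f (hge i hi)
    have : IsIso ((kernel.ι g).f i) := isIso_of_mono_of_epi _
    exact ⟨asIso ((kernel.ι g).f i)⟩

end BrutalTruncation

/-! ### Finite resolutions and perfect approximation -/

section Perfect

variable {R : Type u} [CommRing R]

/-- Used to resolve inside the category of finitely generated modules, where all terms are
automatically finite; the resolution is then transported to all modules. -/
lemma exists_epi_from_finite_free [IsNoetherianRing R] (M : FGModuleCat.{u} R) :
    ∃ (L : FGModuleCat.{u} R) (f : L ⟶ M), Module.Free R L.obj ∧ Epi f := by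
  have : Module.Finite R M.obj := M.property
  obtain ⟨n, f, hf⟩ := Module.Finite.exists_fin' R M.obj
  refine ⟨FGModuleCat.of R (Fin n → R), FGModuleCat.ofHom f,
    inferInstanceAs (Module.Free R (Fin n → R)), ?_⟩
  apply (forget₂ (FGModuleCat.{u} R) (ModuleCat.{u} R)).epi_of_epi_map
  exact (ModuleCat.epi_iff_surjective _).2 hf

lemma projective_fgModuleCat [IsNoetherianRing R] (P : FGModuleCat.{u} R)
    [Module.Projective R P.obj] : Projective P where
  factors {E X} f e he := by
    let F := forget₂ (FGModuleCat.{u} R) (ModuleCat.{u} R)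
    have : Projective (F.obj P) :=
      ModuleCat.projective_of_categoryTheory_projective P.obj
    obtain ⟨g, hg⟩ := Projective.factors (F.map f) (F.map e)
    obtain ⟨g, rfl⟩ := F.map_surjective g
    exact ⟨g, F.map_injective (by rw [F.map_comp, hg])⟩

instance [IsNoetherianRing R] : EnoughProjectives (FGModuleCat.{u} R) where
  presentation M := by
    obtain ⟨L, f, hL, hf⟩ := exists_epi_from_finite_free M
    exact ⟨{ p := L, projective := projective_fgModuleCat L, f := f, epi := hf }⟩

instance [IsNoetherianRing R] :
    (forget₂ (FGModuleCat.{u} R) (ModuleCat.{u} R)).PreservesProjectiveObjects where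
  projective_obj {P} hP := by
    let F := forget₂ (FGModuleCat.{u} R) (ModuleCat.{u} R)
    obtain ⟨L, f, hL, hf⟩ := exists_epi_from_finite_free P
    have : Projective (F.obj L) :=
      ModuleCat.projective_of_categoryTheory_projective L.obj
    let r : Retract P L := ⟨Projective.factorThru (𝟙 P) f, f, by simp⟩
    exact (r.map F).projective

/-- A finitely generated module over a noetherian ring has a resolution by finitely generated
projective modules. -/
lemma exists_finite_projectiveResolution [IsNoetherianRing R] (M : ModuleCat.{u} R)
    (hM : Module.Finite R M) :
    ∃ P : ProjectiveResolution M, ∀ n, Module.Finite R (P.complex.X n) := by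
  let F := forget₂ (FGModuleCat.{u} R) (ModuleCat.{u} R)
  let Z : FGModuleCat.{u} R := ⟨M, hM⟩
  exact ⟨F.mapProjectiveResolution (ProjectiveResolution.of Z),
    fun n ↦ ((ProjectiveResolution.of Z).complex.X n).property⟩

lemma finite_cochainComplex_X {M : ModuleCat.{u} R} (P : ProjectiveResolution M)
    (hP : ∀ n, Module.Finite R (P.complex.X n)) (i : ℤ) :
    Module.Finite R (P.cochainComplex.X i) := by
  by_cases hi : i ≤ 0
  · have := hP (-i).toNat
    exact Module.Finite.equiv (P.cochainComplexXIso i (-i).toNat).symm.toLinearEquiv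
  · have := ModuleCat.subsingleton_of_isZero
      (CochainComplex.isZero_of_isStrictlyLE P.cochainComplex 0 i)
    infer_instance

variable [HasDerivedCategory.{w} (ModuleCat.{u} R)]

/-- A finitely generated module over a noetherian ring is approximated by perfect complexes:
the truncations of a resolution. -/
lemma exists_perfect_approximation [IsNoetherianRing R] (M : ModuleCat.{u} R)
    (hM : Module.Finite R M) (n : ℤ) :
    ∃ (A : DerivedCategory (ModuleCat.{u} R)) (f : A ⟶ (DerivedCategory.singleFunctor _ 0).obj M),
      IsPerfect R A ∧ ∀ (Y : DerivedCategory (ModuleCat.{u} R)) (_ : Y.IsGE n) (g : _ ⟶ Y),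
        f ≫ g = 0 → g = 0 := by
  obtain ⟨P, hP⟩ := exists_finite_projectiveResolution M hM
  have hfin := finite_cochainComplex_X P hP
  have hLE : P.cochainComplex.IsStrictlyLE 0 := inferInstance
  have hproj (i : ℤ) : Projective (P.cochainComplex.X i) := inferInstance
  have e : DerivedCategory.Q.obj P.cochainComplex ≅ (DerivedCategory.singleFunctor _ 0).obj M :=
    asIso (DerivedCategory.Q.map P.π') ≪≫
      (DerivedCategory.singleFunctorIsoCompQ (ModuleCat.{u} R) 0).symm.app M
  generalize P.cochainComplex = K at *
  obtain ⟨S, hS, rfl, hB, hA, hiso⟩ := exists_brutal_truncation K n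
  refine ⟨DerivedCategory.Q.obj S.X₁, DerivedCategory.Q.map S.f ≫ e.hom,
    ⟨S.X₁, fun i ↦ ?_, ⟨n, 0, hA, ?_⟩, ⟨Iso.refl _⟩⟩, fun Y hY g hg ↦ ?_⟩
  · by_cases hi : n ≤ i
    · obtain ⟨e⟩ := hiso i hi
      have := hfin i
      have := hproj i
      exact ⟨Module.Finite.equiv e.symm.toLinearEquiv,
        Module.Projective.of_equiv e.symm.toLinearEquiv⟩
    · have := ModuleCat.subsingleton_of_isZero (CochainComplex.isZero_of_isStrictlyGE S.X₁ n i)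
      exact ⟨inferInstance, inferInstance⟩
  · rw [CochainComplex.isStrictlyLE_iff]
    intro i hi
    by_cases hi : n ≤ i
    · obtain ⟨e⟩ := hiso i hi
      exact (CochainComplex.isZero_of_isStrictlyLE S.X₂ 0 i).of_iso e
    · exact CochainComplex.isZero_of_isStrictlyGE S.X₁ n i
  · obtain ⟨h, hh⟩ := Triangle.yoneda_exact₂ _ (DerivedCategory.triangleOfSES_distinguished hS)
      (e.hom ≫ g) ((Category.assoc _ _ _).symm.trans hg)
    -- The quotient lives in degrees below `n` and `Y` in degrees at least `n`.
    have : h = 0 := by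
      have : (DerivedCategory.Q.obj S.X₃).IsLE (n - 1) := inferInstance
      exact DerivedCategory.TStructure.t.zero_of_isLE_of_isGE h (n - 1) n (by lia) this hY
    rw [← cancel_epi e.hom, comp_zero]
    exact hh.trans (by rw [this]; exact comp_zero)

end Perfect

/-! ### Stability of ghosts -/

section ShiftGhost

variable {T : Type*} [Category T] [HasShift T ℤ] [Preadditive T]

lemma IsGhost.comp {C : ObjectProperty T} {Y Z Z' : T} {φ : Y ⟶ Z} (hφ : IsGhost C φ)
    (g : Z ⟶ Z') : IsGhost C (φ ≫ g) := fun X hX n f ↦ by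
  rw [← Category.assoc, hφ hX, zero_comp]

variable [∀ n : ℤ, (shiftFunctor T n).Additive]

lemma IsGhost.shift {C : ObjectProperty T} {Y Z : T} {φ : Y ⟶ Z} (hφ : IsGhost C φ) (m : ℤ) :
    IsGhost C (φ⟦m⟧') := fun X hX n f ↦ by
  apply (shiftFunctor T (-m)).map_injective
  have h := hφ hX (n + -m) ((shiftFunctorAdd T n (-m)).hom.app X ≫ f⟦-m⟧' ≫
    (shiftFunctorCompIsoId T m (-m) (add_neg_cancel m)).hom.app Y)
  have hnat := (shiftFunctorCompIsoId T m (-m) (add_neg_cancel m)).hom.naturality φ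
  dsimp at hnat
  rw [Category.assoc, Category.assoc, ← hnat, ← comp_zero
    (f := (shiftFunctorAdd T n (-m)).hom.app X), cancel_epi, ← Category.assoc,
    ← zero_comp (f := (shiftFunctorCompIsoId T m (-m) (add_neg_cancel m)).hom.app Z)] at h
  erw [cancel_mono] at h
  rw [Functor.map_comp, h, Functor.map_zero]

end ShiftGhost

/-! ### Ext classes as composites of ghosts -/

section Ring

open Abelian DerivedCategory

variable {R : Type u} [CommRing R]

/-- The right orthogonal of the finitely generated Gorenstein projective modules. -/
def IsRightOrthogonal (N : ModuleCat.{u} R) : Prop :=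
  ∀ G : ModuleCat.{u} R, Module.Finite R G → IsGorensteinProjective R G →
    ∀ (n : ℕ) (x : Ext G N (n + 1)), x = 0

lemma IsRightOrthogonal.of_shortExact {S : ShortComplex (ModuleCat.{u} R)} (hS : S.ShortExact)
    (h₁ : IsRightOrthogonal S.X₁) [Injective S.X₂] : IsRightOrthogonal S.X₃ := fun G hG hG' n x ↦ by
  obtain ⟨y, rfl⟩ := Ext.covariant_sequence_exact₃ G hS x rfl (h₁ G hG hG' _ _)
  rw [Ext.eq_zero_of_injective y, Ext.zero_comp]

variable [HasDerivedCategory.{w} (ModuleCat.{u} R)]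

lemma shiftedHom_eq_zero_of_ext_eq_zero {G N : ModuleCat.{u} R} {k : ℕ}
    (h : ∀ x : Ext G N k, x = 0) {a b : ℤ} (hab : a + k = b)
    (f : ((singleFunctor _ 0).obj G)⟦a⟧ ⟶ ((singleFunctor _ 0).obj N)⟦b⟧) : f = 0 := by
  obtain ⟨x, hx⟩ := Ext.homEquiv.surjective
    ((shiftFunctorCompIsoId _ a (-a) (add_neg_cancel a)).inv.app _ ≫ f⟦-a⟧' ≫
      (shiftFunctorAdd' _ b (-a) (k : ℤ) (by lia)).inv.app _ :
        ShiftedHom ((singleFunctor _ 0).obj G) ((singleFunctor _ 0).obj N) (k : ℤ))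
  rw [h x] at hx
  change Ext.hom 0 = _ at hx
  rw [Ext.zero_hom, ← comp_zero (f := (shiftFunctorCompIsoId _ a (-a)
    (add_neg_cancel a)).inv.app _)] at hx
  erw [cancel_epi] at hx
  rw [← zero_comp (f := (shiftFunctorAdd' _ b (-a) (k : ℤ) (by lia)).inv.app _)] at hx
  erw [cancel_mono] at hx
  apply (shiftFunctor _ (-a)).map_injective
  rw [Functor.map_zero]
  exact hx.symm

lemma IsRightOrthogonal.isGhost {C N : ModuleCat.{u} R} (hN : IsRightOrthogonal N)
    (x : Ext C N 1) : IsGhost (finGorensteinProjectives R) x.hom := by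
  rintro X ⟨G, hG, hG', ⟨e⟩⟩ n f
  rw [← cancel_epi (e.inv⟦n⟧'), comp_zero, ← Category.assoc]
  generalize e.inv⟦n⟧' ≫ f = g
  -- For `n ≤ 0` the composite is a class in Ext^{1-n}(G, N) = 0; for `n > 0` the map from G[n] to C
  -- is already zero, being of negative degree.
  obtain hn | hn := le_or_gt n 0
  · exact shiftedHom_eq_zero_of_ext_eq_zero (hN G hG hG' (-n).toNat) (by lia) _
  · have : g = 0 := by
      have := TStructure.t.isLE_shift ((singleFunctor (ModuleCat.{u} R) 0).obj G) 0 n (-n)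
      exact TStructure.t.zero g (-n) 0
    rw [this, zero_comp]

/-- A class in `Ext M N (n + 1)` factors through a composite of `n` ghosts if `N` is right
orthogonal to the Gorenstein projective modules. -/
lemma IsRightOrthogonal.exists_isGhostComp (n : ℕ) {M N : ModuleCat.{u} R}
    (hN : IsRightOrthogonal N) (x : Ext M N (n + 1)) :
    ∃ (Z : DerivedCategory (ModuleCat.{u} R)) (y : (singleFunctor _ 0).obj M ⟶ Z)
      (g : Z ⟶ ((singleFunctor _ 0).obj N)⟦((n + 1 : ℕ) : ℤ)⟧),
      IsGhostComp (finGorensteinProjectives R) n g ∧ y ≫ g = x.hom := by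
  induction n generalizing N with
  | zero => exact ⟨_, x.hom, 𝟙 _, trivial, Category.comp_id _⟩
  | succ n ih =>
    obtain ⟨I, hI, f, hf⟩ := EnoughInjectives.presentation N
    have hS : (ShortComplex.mk f _ (cokernel.condition f)).ShortExact :=
      { exact := ShortComplex.exact_cokernel f }
    obtain ⟨x', rfl⟩ := Ext.covariant_sequence_exact₁ M hS x (Ext.eq_zero_of_injective _) rfl
    obtain ⟨Z, y, g, hg, hy⟩ := ih (.of_shortExact hS hN) x'
    -- The new ghost is the shifted connecting class of the cosyzygy sequence.
    refine ⟨Z, y, _, hg.comp (((hN.isGhost hS.extClass).shift _).comp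
      ((shiftFunctorAdd' _ _ _ _ (by lia)).inv.app _)), ?_⟩
    rw [Ext.comp_hom, ShiftedHom.comp, ← hy, Category.assoc]

lemma IsRightOrthogonal.ext_eq_zero_of_gLevel_le [IsNoetherianRing R] {n : ℕ}
    (h : ∀ P : DerivedCategory (ModuleCat.{u} R), IsPerfect R P → gLevel R P ≤ n)
    {M N : ModuleCat.{u} R} (hM : Module.Finite R M) (hN : IsRightOrthogonal N)
    (x : Ext M N (n + 1)) : x = 0 := by
  obtain ⟨Z, y, g, hg, hy⟩ := hN.exists_isGhostComp n x
  -- N[n+1] sits in degree -(n+1), so truncating there suffices to detect maps into it.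
  obtain ⟨A, f, hA, hf⟩ := exists_perfect_approximation M hM (-(n + 1 : ℕ))
  apply Ext.ext
  rw [Ext.zero_hom]
  refine hf _ ?_ x.hom ?_
  · exact TStructure.t.isGE_shift _ 0 _ _
  · rw [← hy, ← Category.assoc]
    exact comp_eq_zero_of_level_le (h A hA) hg _

end Ring

end GLevel

end

theorem mainTheorem4 (R : Type u) [CommRing R] [IsNoetherianRing R] [IsLocalRing R]
    [HasDerivedCategory.{w} (ModuleCat.{u} R)]
    (hbound : ∃ ℓ : ℕ, ∀ P : DerivedCategory (ModuleCat.{u} R),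
      GLevel.IsPerfect R P → GLevel.gLevel R P ≤ (ℓ : ℕ∞)) :
    GLevel.IsGorensteinLocalRing R := by
  obtain ⟨ℓ, hℓ⟩ := hbound
  have hR : GLevel.IsRightOrthogonal (ModuleCat.of R R) := fun G _ hG n x ↦
    hG.ext_eq_zero _ (inferInstanceAs (Module.Projective R R)) n x
  exact ⟨inferInstance, inferInstance, ℓ,
    GLevel.hasInjectiveDimensionLE_of_ext_finite_eq_zero ℓ fun M hM x ↦
      hR.ext_eq_zero_of_gLevel_le hℓ hM x⟩
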